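/- Let $X$ be an alphabet and let $E$ be a quantum system with (complex) Hilbert space $\mathcal H_E$; the classical register $X$ is described by $\ell^2(X)$ with orthonormal basis $\{|x\rangle\}_{x\in X}$. A state is a positive operator of trace one, the trace distance is $D(\rho,\rho_*)=\tfrac12\operatorname{tr}|\rho-\rho_*|$, and for $\epsilon\ge 0$ the $\epsilon$-ball $\mathcal B^\epsilon(\rho)$ of a state $\rho$ of $XE$ is the set of all states $\rho_*$ of $XE$ with $D(\rho,\rho_*)\le \epsilon^2/2$. The conditional min-entropy of a state $\rho$ of $XE$ is $$H_{\min}(X|E)_\rho=\sup_{\sigma}\,\sup\{\lambda\in\mathbb R:\ \rho\le 2^{-\lambda}\, I_X\otimes\sigma\},$$ where $\sigma$ ranges over the states of $E$, and the conditional smooth min-entropy is $$H^{\epsilon}_{\min}(X|E)_\rho=\sup_{\rho_*\in\mathcal B^\epsilon(\rho)}H_{\min}(X|E)_{\rho_*}.$$ **Proposition.** Let $\rho=\sum_{x\in X}P(x)\,|x\rangle\langle x|\otimes\omega(x)$ be a classical-quantum state on $XE$, where $P$ is a probability distribution on $X$ and every $\omega(x)$ is a state of $E$. Let $S\subseteq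 X$, $\Pi=\sum_{x\in S}|x\rangle\langle x|\otimes I_E$, $p=\operatorname{tr}\Pi\rho\Pi$, suppose that $p>0$, and let $\tau=p^{-1}\,\Pi\rho\Pi$. Then for every $\epsilon$ with $0\le\epsilon<\sqrt2$, $$H^{\epsilon}_{\min}(X|E)_\tau\ \ge\ H^{\epsilon\sqrt{p/2}}_{\min}(X|E)_\rho+\log_2\!\big[p\,(1-\epsilon^2/2)\big].$$ -/

import Mathlib

open scoped ENNReal InnerProductSpace

noncomputable section

section General

variable {H : Type*} [NormedAddCommGroup H] [InnerProductSpace ℂ H] [CompleteSpace H]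

/-- The trace `∑ ⟨e i, T e i⟩ ∈ [0, ∞]` of a positive bounded operator on a Hilbert space, computed
in some Hilbert basis `e`. By `posTrace_eq_tsum` it is the same in every Hilbert basis. The function
is only ever applied to positive operators. -/
def posTrace (T : H →L[ℂ] H) : ℝ≥0∞ :=
  ∑' i, ENNReal.ofReal
    (⟪(exists_hilbertBasis ℂ H).choose_spec.choose i,
      T ((exists_hilbertBasis ℂ H).choose_spec.choose i)⟫_ℂ).re

theorem tsum_norm_inner_sq {H : Type*} [NormedAddCommGroup H] [InnerProductSpace ℂ H]
    {ι : Type*} (b : HilbertBasis ι ℂ H) (v : H) :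
    ∑' i, ENNReal.ofReal (‖⟪b i, v⟫_ℂ‖ ^ 2) = ENNReal.ofReal (‖v‖ ^ 2) := by
  have h := b.hasSum_inner_mul_inner v v
  have h2 : HasSum (fun i => ‖⟪b i, v⟫_ℂ‖ ^ 2) (‖v‖ ^ 2) := by
    have h3 := Complex.hasSum_re h
    have e1 : ∀ i, (⟪v, b i⟫_ℂ * ⟪b i, v⟫_ℂ).re = ‖⟪b i, v⟫_ℂ‖ ^ 2 := by
      intro i
      rw [← inner_conj_symm v (b i), Complex.conj_mul']
      norm_cast
    have e2 : (⟪v, v⟫_ℂ).re = ‖v‖ ^ 2 := by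
      rw [inner_self_eq_norm_sq_to_K]
      norm_cast
    simpa only [e1, e2] using h3
  rw [← ENNReal.ofReal_tsum_of_nonneg (fun i => by positivity) h2.summable, h2.tsum_eq]

/-- The trace of a positive operator does not depend on the Hilbert basis. -/
theorem tsum_re_inner_eq_of_nonneg {ι κ : Type*} (b : HilbertBasis ι ℂ H) (c : HilbertBasis κ ℂ H)
    {T : H →L[ℂ] H} (hT : 0 ≤ T) :
    ∑' i, ENNReal.ofReal (⟪b i, T (b i)⟫_ℂ).re = ∑' j, ENNReal.ofReal (⟪c j, T (c j)⟫_ℂ).re := by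
  obtain ⟨R, hR, hRT⟩ : ∃ R : H →L[ℂ] H, IsSelfAdjoint R ∧ R * R = T :=
    ⟨CFC.sqrt T, (CFC.sqrt_nonneg T).isSelfAdjoint, CFC.sqrt_mul_sqrt_self T hT⟩
  have hsymm : ∀ u v : H, ⟪R u, v⟫_ℂ = ⟪u, R v⟫_ℂ := hR.isSymmetric
  have key : ∀ v : H, (⟪v, T v⟫_ℂ).re = ‖R v‖ ^ 2 := by
    intro v
    rw [← hRT, mul_apply_eq_comp, ← hsymm, inner_self_eq_norm_sq_to_K]
    norm_cast
  simp only [key]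
  calc ∑' i, ENNReal.ofReal (‖R (b i)‖ ^ 2)
      = ∑' i, ∑' j, ENNReal.ofReal (‖⟪c j, R (b i)⟫_ℂ‖ ^ 2) := by
        simp only [tsum_norm_inner_sq c]
    _ = ∑' j, ∑' i, ENNReal.ofReal (‖⟪b i, R (c j)⟫_ℂ‖ ^ 2) := by
        rw [ENNReal.tsum_comm]
        refine tsum_congr fun j => tsum_congr fun i => ?_
        rw [← hsymm, norm_inner_symm]
    _ = ∑' j, ENNReal.ofReal (‖R (c j)‖ ^ 2) := by
        simp only [tsum_norm_inner_sq b]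

theorem posTrace_eq_tsum {ι : Type*} (b : HilbertBasis ι ℂ H) {T : H →L[ℂ] H} (hT : 0 ≤ T) :
    posTrace T = ∑' i, ENNReal.ofReal (⟪b i, T (b i)⟫_ℂ).re :=
  tsum_re_inner_eq_of_nonneg _ b hT

/-- A (normalized) quantum state: a positive operator of trace one. -/
def IsState (T : H →L[ℂ] H) : Prop := 0 ≤ T ∧ posTrace T = 1

/-- The trace distance `D(A, B) = ½ tr |A - B|`, where `|T| = √(T⋆ T)`. -/
def traceDist (A B : H →L[ℂ] H) : ℝ≥0∞ := posTrace (CFC.abs (A - B)) / 2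

/-- The `ε`-ball of states around `ρ`: the states `ρ'` with `D(ρ, ρ') ≤ ε² / 2`. -/
def stateBall (ε : ℝ) (ρ : H →L[ℂ] H) : Set (H →L[ℂ] H) :=
  {ρ' | IsState ρ' ∧ traceDist ρ ρ' ≤ ENNReal.ofReal (ε ^ 2 / 2)}

end General

/-- The Hilbert space of the joint system `XE`: the tensor product `ℓ²(X) ⊗ E`, realised as the
space `ℓ²(X; E)` of square-summable families of vectors of `E`, with `|x⟩ ⊗ v` being the
family that has `v` at `x` and `0` elsewhere. -/
abbrev JointSpace (X E : Type*) [NormedAddCommGroup E] : Type _ := lp (fun _ : X => E) 2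

section Joint

variable {X E : Type*} [NormedAddCommGroup E] [InnerProductSpace ℂ E]

theorem memlp_blockDiag (T : X → E →L[ℂ] E) (C : ℝ) (hT : ∀ x, ‖T x‖ ≤ C) (f : JointSpace X E) :
    Memℓp (fun x => T x (f x)) 2 :=
  Memℓp.mono (g := fun x => C * ‖f x‖) ((Memℓp.norm (lp.memℓp f)).const_mul C)
    (fun x => (T x).le_of_opNorm_le (hT x) (f x))

/-- The block-diagonal operator `∑ x, |x⟩⟨x| ⊗ T x` of a uniformly bounded family `T`, which maps
`f` to `x ↦ T x (f x)`. -/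
def blockDiag (T : X → E →L[ℂ] E) (C : ℝ) (hT : ∀ x, ‖T x‖ ≤ C) :
    JointSpace X E →L[ℂ] JointSpace X E :=
  LinearMap.mkContinuous
    { toFun := fun f => ⟨fun x => T x (f x), memlp_blockDiag T C hT f⟩
      map_add' := fun f g => by
        ext x
        exact map_add (T x) (f x) (g x)
      map_smul' := fun c f => by
        ext x
        simp }
    ‖(C : ℂ)‖ (fun f => by
      rw [← norm_smul]
      refine lp.norm_mono (by norm_num) fun x => ?_
      refine ((T x).le_of_opNorm_le (hT x) (f x)).trans ?_
      simp only [lp.coeFn_smul, Pi.smul_apply, norm_smul, Complex.norm_real]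
      exact mul_le_mul_of_nonneg_right (le_abs_self C) (norm_nonneg _))

theorem blockDiag_apply (T : X → E →L[ℂ] E) (C : ℝ) (hT : ∀ x, ‖T x‖ ≤ C) (f : JointSpace X E)
    (x : X) : blockDiag T C hT f x = T x (f x) := rfl

/-- The operator `1_X ⊗ σ`. -/
def idTensor (X : Type*) (σ : E →L[ℂ] E) : JointSpace X E →L[ℂ] JointSpace X E :=
  blockDiag (fun _ => σ) ‖σ‖ (fun _ => le_rfl)

open Classical in
/-- The projector `Π = ∑ x ∈ S, |x⟩⟨x| ⊗ 1_E`. -/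
def registerProj (E : Type*) [NormedAddCommGroup E] [InnerProductSpace ℂ E] (S : Set X) :
    JointSpace X E →L[ℂ] JointSpace X E :=
  blockDiag (fun x => if x ∈ S then ContinuousLinearMap.id ℂ E else 0) 1 (fun x => by
    split_ifs
    · exact ContinuousLinearMap.norm_id_le
    · simp)

open Classical in
/-- The operator `|x⟩⟨x| ⊗ A`. -/
def ketbraTensor (x : X) (A : E →L[ℂ] E) : JointSpace X E →L[ℂ] JointSpace X E :=
  lp.singleContinuousLinearMap ℂ (fun _ : X => E) 2 x ∘L A ∘L
    lp.evalCLM ℂ (fun _ : X => E) 2 x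

variable [CompleteSpace E]

/-- `ρ` is a classical-quantum state on `XE`: `ρ = ∑ x, P x |x⟩⟨x| ⊗ ω x` (convergence in operator
norm) for a probability distribution `P` on the alphabet `X` and states `ω x` of `E`. -/
def IsCQState (ρ : JointSpace X E →L[ℂ] JointSpace X E) : Prop :=
  ∃ (P : X → ℝ) (ω : X → E →L[ℂ] E), (∀ x, 0 ≤ P x) ∧ HasSum P 1 ∧ (∀ x, IsState (ω x)) ∧
    HasSum (fun x => (P x : ℂ) • ketbraTensor x (ω x)) ρ

/-- The probability `p = tr Π ρ Π` of finding the classical register in `S`. -/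
def projProb (S : Set X) (ρ : JointSpace X E →L[ℂ] JointSpace X E) : ℝ :=
  (posTrace (registerProj E S ∘L ρ ∘L registerProj E S)).toReal

/-- The projected normalized state `τ = p⁻¹ Π ρ Π`. -/
def projState (S : Set X) (ρ : JointSpace X E →L[ℂ] JointSpace X E) :
    JointSpace X E →L[ℂ] JointSpace X E :=
  (((projProb S ρ)⁻¹ : ℝ) : ℂ) • (registerProj E S ∘L ρ ∘L registerProj E S)

/-- The conditional min-entropy `H_min(X|E)_ρ`: the supremum, over the states `σ` of `E`, of
`sup {l : ℝ | ρ ≤ 2^(-l) 1_X ⊗ σ}`. -/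
def condMinEntropy (ρ : JointSpace X E →L[ℂ] JointSpace X E) : EReal :=
  ⨆ (σ : E →L[ℂ] E) (_ : IsState σ) (l : ℝ)
    (_ : ρ ≤ (((2 : ℝ) ^ (-l) : ℝ) : ℂ) • idTensor X σ), (l : EReal)

/-- The conditional smooth min-entropy `H_min^ε(X|E)_ρ`. -/
def condSmoothMinEntropy (ε : ℝ) (ρ : JointSpace X E →L[ℂ] JointSpace X E) : EReal :=
  ⨆ ρ' ∈ stateBall ε ρ, condMinEntropy ρ'

end Joint

end

/-!
Measuring the classical register and conditioning on the outcome `S` turns a near-optimal smoothing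
`ρ'` of `ρ` into a smoothing of `τ`. Write `q = tr Π ρ' Π` and `τ' = q⁻¹ Π ρ' Π`.

* If `ρ' ≤ 2^(-l) 1 ⊗ σ`, then `Π ρ' Π ≤ 2^(-l) Π (1 ⊗ σ) Π ≤ 2^(-l) 1 ⊗ σ`, so that
  `τ' ≤ 2^(-(l + log₂ q)) 1 ⊗ σ`.
* Split `ρ - ρ' = A⁺ - A⁻` into its positive and negative part and let `b± = tr Π A± Π`. Compression
  by `Π` does not increase traces (`posTrace_conj_le`), so `b⁺ + b⁻ ≤ tr |ρ - ρ'| ≤ ε² p / 2`. As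
  `p - q = b⁺ - b⁻`, this gives `q ≥ p (1 - ε² / 2) > 0`.
* The trace norm is dominated by `tr P + tr N` for every decomposition into a difference `P - N` of
  positive operators (`posTrace_abs_sub_le`). Applied to
  `τ - τ' = p⁻¹ (Π A⁺ Π - Π A⁻ Π) + (p⁻¹ - q⁻¹) Π ρ' Π`, it bounds `tr |τ - τ'|` by
  `p⁻¹ (b⁺ + b⁻) + p⁻¹ |q - p| ≤ 2 p⁻¹ (b⁺ + b⁻) ≤ ε²`, so `τ'` lies in the `ε`-ball around `τ`
  (`traceDist_normalized_compression_le`).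
-/

/-! ### Trace and trace distance of positive operators -/

section PositiveTrace

variable {H : Type*} [NormedAddCommGroup H] [InnerProductSpace ℂ H]

theorem re_inner_nonneg_of_nonneg {T : H →L[ℂ] H} (hT : 0 ≤ T) (v : H) : 0 ≤ (⟪v, T v⟫_ℂ).re :=
  ((ContinuousLinearMap.nonneg_iff_isPositive T).1 hT).re_inner_nonneg_right v

theorem ofReal_smul_nonneg {T : H →L[ℂ] H} (hT : 0 ≤ T) {r : ℝ} (hr : 0 ≤ r) :
    0 ≤ (r : ℂ) • T := by
  rw [ContinuousLinearMap.nonneg_iff_isPositive] at hT ⊢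
  exact hT.smul_of_nonneg (by exact_mod_cast hr)

variable [CompleteSpace H]

theorem posTrace_add {A B : H →L[ℂ] H} (hA : 0 ≤ A) (hB : 0 ≤ B) :
    posTrace (A + B) = posTrace A + posTrace B := by
  simp only [posTrace]
  rw [← ENNReal.tsum_add]
  refine tsum_congr fun i => ?_
  rw [add_apply, inner_add_right, Complex.add_re,
    ENNReal.ofReal_add (re_inner_nonneg_of_nonneg hA _) (re_inner_nonneg_of_nonneg hB _)]

theorem posTrace_mono {A B : H →L[ℂ] H} (hA : 0 ≤ A) (hAB : A ≤ B) :
    posTrace A ≤ posTrace B := by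
  have h := posTrace_add hA (sub_nonneg.2 hAB)
  rw [add_sub_cancel] at h
  exact h ▸ le_self_add

theorem posTrace_smul (T : H →L[ℂ] H) {r : ℝ} (hr : 0 ≤ r) :
    posTrace ((r : ℂ) • T) = ENNReal.ofReal r * posTrace T := by
  simp only [posTrace]
  rw [← ENNReal.tsum_mul_left]
  refine tsum_congr fun i => ?_
  rw [smul_apply, inner_smul_right, Complex.re_ofReal_mul,
    ENNReal.ofReal_mul hr]

/-- Compression by a self-adjoint contraction does not increase the trace of a positive operator.
With `R = √T`, the trace of `C T C = (R C)⋆ (R C)` is that of `(R C) (R C)⋆ = R C² R ≤ R²`. -/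
theorem posTrace_conj_le {T C : H →L[ℂ] H} (hT : 0 ≤ T) (hC : IsSelfAdjoint C) (hC1 : ‖C‖ ≤ 1) :
    posTrace (C * T * C) ≤ posTrace T := by
  obtain ⟨R, hR, hRT⟩ : ∃ R : H →L[ℂ] H, IsSelfAdjoint R ∧ R * R = T :=
    ⟨CFC.sqrt T, (CFC.sqrt_nonneg T).isSelfAdjoint, CFC.sqrt_mul_sqrt_self T hT⟩
  have hRs : ∀ u v : H, ⟪R u, v⟫_ℂ = ⟪u, R v⟫_ℂ := hR.isSymmetric
  have hCs : ∀ u v : H, ⟪C u, v⟫_ℂ = ⟪u, C v⟫_ℂ := hC.isSymmetric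
  have key : ∀ v : H, (⟪v, T v⟫_ℂ).re = ‖R v‖ ^ 2 := by
    intro v
    rw [← hRT, mul_apply_eq_comp, ← hRs, inner_self_eq_norm_sq_to_K]
    norm_cast
  have key2 : ∀ v : H, (⟪v, (C * T * C) v⟫_ℂ).re = ‖R (C v)‖ ^ 2 := by
    intro v
    rw [mul_apply_eq_comp, mul_apply_eq_comp, ← hCs, key]
  simp only [posTrace, key, key2]
  set b := (exists_hilbertBasis ℂ H).choose_spec.choose
  calc ∑' i, ENNReal.ofReal (‖R (C (b i))‖ ^ 2)
      = ∑' i, ∑' j, ENNReal.ofReal (‖⟪b j, R (C (b i))⟫_ℂ‖ ^ 2) := by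
        simp only [tsum_norm_inner_sq b]
    _ = ∑' j, ∑' i, ENNReal.ofReal (‖⟪b i, C (R (b j))⟫_ℂ‖ ^ 2) := by
        rw [ENNReal.tsum_comm]
        refine tsum_congr fun j => tsum_congr fun i => ?_
        rw [← hRs, ← hCs, norm_inner_symm]
    _ = ∑' j, ENNReal.ofReal (‖C (R (b j))‖ ^ 2) := by
        simp only [tsum_norm_inner_sq b]
    _ ≤ ∑' j, ENNReal.ofReal (‖R (b j)‖ ^ 2) := by
        refine ENNReal.tsum_le_tsum fun j => ENNReal.ofReal_le_ofReal ?_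
        have := C.le_of_opNorm_le hC1 (R (b j))
        rw [one_mul] at this
        gcongr

/-- The Jordan decomposition has the least total trace among all decompositions of an operator into
a difference of positive operators. -/
theorem posTrace_abs_sub_le {P N : H →L[ℂ] H} (hP : 0 ≤ P) (hN : 0 ≤ N) :
    posTrace (CFC.abs (P - N)) ≤ posTrace P + posTrace N := by
  set A := P - N
  have hA : IsSelfAdjoint A := hP.isSelfAdjoint.sub hN.isSelfAdjoint
  have hAp : 0 ≤ A⁺ := CFC.posPart_nonneg A
  have hAn : 0 ≤ A⁻ := CFC.negPart_nonneg A
  -- The projection onto `ker A⁻` separates the two parts, as `A⁻ A⁺ = 0`.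
  set K : Submodule ℂ H := LinearMap.ker (A⁻ : H →L[ℂ] H).toLinearMap
  have : CompleteSpace K := (A⁻ : H →L[ℂ] H).isClosed_ker.completeSpace_coe
  set Q := K.starProjection
  have hQ : IsSelfAdjoint Q := isSelfAdjoint_starProjection K
  have hQ' : IsSelfAdjoint (1 - Q) := (IsSelfAdjoint.one _).sub hQ
  have hQn : ‖Q‖ ≤ 1 := K.starProjection_norm_le
  have hQn' : ‖1 - Q‖ ≤ 1 := by
    have := Kᗮ.starProjection_norm_le
    rwa [Submodule.starProjection_orthogonal'] at this
  have h1 : Q * A⁺ = A⁺ := by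
    ext v
    refine Submodule.starProjection_eq_self_iff.2 ?_
    have := congrArg (fun T : H →L[ℂ] H => T v) (CFC.negPart_mul_posPart A)
    exact this
  have h2 : A⁻ * Q = 0 := by
    ext v
    exact K.starProjection_apply_mem v
  have h3 : A⁺ * Q = A⁺ := by
    have := congrArg star h1
    rwa [star_mul, hQ.star_eq, hAp.isSelfAdjoint.star_eq] at this
  have h4 : Q * A⁻ = 0 := by
    have := congrArg star h2
    rwa [star_mul, hQ.star_eq, hAn.isSelfAdjoint.star_eq, star_zero] at this
  have hsub : A⁺ - A⁻ = P - N := CFC.posPart_sub_negPart A hA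
  have e1 : Q * P * Q - A⁺ = Q * N * Q := by
    have : Q * P * Q - Q * N * Q = Q * A⁺ * Q - Q * A⁻ * Q := by
      rw [← sub_mul, ← mul_sub, ← hsub, mul_sub, sub_mul]
    rw [h1, h3, h4, zero_mul, sub_zero] at this
    rw [← this]; abel
  have e2 : (1 - Q) * N * (1 - Q) - A⁻ = (1 - Q) * P * (1 - Q) := by
    have : (1 - Q) * P * (1 - Q) - (1 - Q) * N * (1 - Q)
        = (1 - Q) * A⁺ * (1 - Q) - (1 - Q) * A⁻ * (1 - Q) := by
      rw [← sub_mul, ← mul_sub, ← hsub, mul_sub (1 - Q), sub_mul _ _ (1 - Q)]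
    rw [sub_mul 1 Q A⁺, sub_mul 1 Q A⁻, h1, h4, one_mul, one_mul, sub_self, zero_mul, sub_zero,
      mul_sub A⁻, h2, mul_one, sub_zero, zero_sub] at this
    rw [sub_eq_iff_eq_add.1 this]; abel
  have l1 : posTrace A⁺ ≤ posTrace P :=
    (posTrace_mono hAp (sub_nonneg.1 (e1 ▸ hQ.conjugate_nonneg hN))).trans
      (posTrace_conj_le hP hQ hQn)
  have l2 : posTrace A⁻ ≤ posTrace N :=
    (posTrace_mono hAn (sub_nonneg.1 (e2 ▸ hQ'.conjugate_nonneg hP))).trans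
      (posTrace_conj_le hN hQ' hQn')
  rw [← CFC.posPart_add_negPart A hA, posTrace_add hAp hAn]
  exact add_le_add l1 l2

/-- Let `p` and `q` be the traces of the compressions of `A` and `B` by `C`. If `tr |A - B| ≤ d`,
then `q ≥ p - d`, and the normalized compressions have trace distance at most `d / p`: one half of
this comes from the compressions themselves, the other from the change `|q - p|` of
normalization. -/
theorem traceDist_normalized_compression_le {A B C : H →L[ℂ] H} (hA : 0 ≤ A) (hB : 0 ≤ B)
    (hC : IsSelfAdjoint C) (hC1 : ‖C‖ ≤ 1) {p q d : ℝ} (hp : 0 < p) (hq : 0 ≤ q) (hdp : d < p)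
    (hpA : posTrace (C * A * C) = ENNReal.ofReal p)
    (hqB : posTrace (C * B * C) = ENNReal.ofReal q)
    (hd0 : 0 ≤ d) (hd : traceDist A B ≤ ENNReal.ofReal (d / 2)) :
    p - d ≤ q ∧
      traceDist (((p⁻¹ : ℝ) : ℂ) • (C * A * C)) (((q⁻¹ : ℝ) : ℂ) • (C * B * C))
        ≤ ENNReal.ofReal (d / p) := by
  have hsa : IsSelfAdjoint (A - B) := hA.isSelfAdjoint.sub hB.isSelfAdjoint
  have hMp : 0 ≤ (A - B)⁺ := CFC.posPart_nonneg _
  have hMn : 0 ≤ (A - B)⁻ := CFC.negPart_nonneg _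
  have hsub : (A - B)⁺ - (A - B)⁻ = A - B := CFC.posPart_sub_negPart _ hsa
  rw [traceDist, ENNReal.div_le_iff (by simp) (by simp),
    show (2 : ℝ≥0∞) = ENNReal.ofReal 2 by simp, ← ENNReal.ofReal_mul (by positivity),
    div_mul_cancel₀ d two_ne_zero, ← CFC.posPart_add_negPart (A - B) hsa,
    posTrace_add hMp hMn] at hd
  set M := (A - B)⁺
  set N := (A - B)⁻
  have hM : 0 ≤ C * M * C := hC.conjugate_nonneg hMp
  have hN : 0 ≤ C * N * C := hC.conjugate_nonneg hMn
  have hA' : 0 ≤ C * A * C := hC.conjugate_nonneg hA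
  have hB' : 0 ≤ C * B * C := hC.conjugate_nonneg hB
  have hbound := (add_le_add (posTrace_conj_le hMp hC hC1) (posTrace_conj_le hMn hC hC1)).trans hd
  obtain ⟨hMfin, hNfin⟩ := ENNReal.add_ne_top.1 (ne_top_of_le_ne_top ENNReal.ofReal_ne_top hbound)
  obtain ⟨m, hm0, hm⟩ : ∃ m : ℝ, 0 ≤ m ∧ posTrace (C * M * C) = ENNReal.ofReal m :=
    ⟨_, ENNReal.toReal_nonneg, (ENNReal.ofReal_toReal hMfin).symm⟩
  obtain ⟨n, hn0, hn⟩ : ∃ n : ℝ, 0 ≤ n ∧ posTrace (C * N * C) = ENNReal.ofReal n :=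
    ⟨_, ENNReal.toReal_nonneg, (ENNReal.ofReal_toReal hNfin).symm⟩
  have hmn : m + n ≤ d := by
    rwa [hm, hn, ← ENNReal.ofReal_add hm0 hn0, ENNReal.ofReal_le_ofReal_iff hd0] at hbound
  have hop : C * A * C - C * B * C = C * M * C - C * N * C := by
    rw [← sub_mul, ← mul_sub, ← hsub, mul_sub, sub_mul]
  have hbal : p + n = q + m := by
    have h : C * A * C + C * N * C = C * B * C + C * M * C := by
      rw [sub_eq_iff_eq_add.1 hop]; abel
    have h := congrArg posTrace h
    rwa [posTrace_add hA' hN, posTrace_add hB' hM, hpA, hqB, hm, hn,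
      ← ENNReal.ofReal_add hp.le hn0, ← ENNReal.ofReal_add hq hm0,
      ENNReal.ofReal_eq_ofReal_iff (by positivity) (by positivity)] at h
  have hq0 : 0 < q := by linarith
  refine ⟨by linarith, ?_⟩
  set c := p⁻¹ - q⁻¹ with hc
  have hpi : 0 ≤ p⁻¹ := by positivity
  have hcp : 0 ≤ max c 0 := le_max_right _ _
  have hcn : 0 ≤ max (-c) 0 := le_max_right _ _
  have hcsub : max c 0 - max (-c) 0 = c := max_zero_sub_max_neg_zero_eq_self c
  have hdiff : ((p⁻¹ : ℝ) : ℂ) • (C * A * C) - ((q⁻¹ : ℝ) : ℂ) • (C * B * C)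
      = (((p⁻¹ : ℝ) : ℂ) • (C * M * C) + ((max c 0 : ℝ) : ℂ) • (C * B * C))
        - (((p⁻¹ : ℝ) : ℂ) • (C * N * C) + ((max (-c) 0 : ℝ) : ℂ) • (C * B * C)) := by
    rw [add_sub_add_comm, ← smul_sub, ← hop, ← sub_smul, ← Complex.ofReal_sub, hcsub, hc,
      Complex.ofReal_sub]
    module
  have htr := posTrace_abs_sub_le
    (add_nonneg (ofReal_smul_nonneg hM hpi) (ofReal_smul_nonneg hB' hcp))
    (add_nonneg (ofReal_smul_nonneg hN hpi) (ofReal_smul_nonneg hB' hcn))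
  rw [posTrace_add (ofReal_smul_nonneg hM hpi) (ofReal_smul_nonneg hB' hcp),
    posTrace_add (ofReal_smul_nonneg hN hpi) (ofReal_smul_nonneg hB' hcn),
    posTrace_smul _ hpi, posTrace_smul _ hpi, posTrace_smul _ hcp, posTrace_smul _ hcn,
    hm, hn, hqB, ← ENNReal.ofReal_mul hpi, ← ENNReal.ofReal_mul hpi, ← ENNReal.ofReal_mul hcp,
    ← ENNReal.ofReal_mul hcn, ← ENNReal.ofReal_add (by positivity) (by positivity),
    ← ENNReal.ofReal_add (by positivity) (by positivity),
    ← ENNReal.ofReal_add (by positivity) (by positivity)] at htr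
  rw [traceDist, hdiff]
  refine (ENNReal.div_le_div_right htr 2).trans ?_
  rw [show (2 : ℝ≥0∞) = ENNReal.ofReal 2 by simp, ← ENNReal.ofReal_div_of_pos two_pos]
  refine ENNReal.ofReal_le_ofReal ?_
  have habs : max c 0 * q + max (-c) 0 * q = p⁻¹ * |q - p| := by
    have h1 : c * q = p⁻¹ * (q - p) := by rw [hc]; field_simp
    have h2 : max c 0 + max (-c) 0 = |c| := max_zero_add_max_neg_zero_eq_abs_self c
    rw [← add_mul, h2, ← abs_of_pos hq0, ← abs_mul, abs_of_pos hq0, h1, abs_mul, abs_of_nonneg hpi]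
  have hqp : |q - p| ≤ d := abs_le.2 ⟨by linarith, by linarith⟩
  calc (p⁻¹ * m + max c 0 * q + (p⁻¹ * n + max (-c) 0 * q)) / 2
      = p⁻¹ * ((m + n) + |q - p|) / 2 := by rw [mul_add, ← habs]; ring
    _ ≤ p⁻¹ * (d + d) / 2 := by gcongr
    _ = d / p := by field_simp; ring

end PositiveTrace

/-! ### Compression to outcomes of the classical register -/

section Register

variable {X E : Type*} [NormedAddCommGroup E] [InnerProductSpace ℂ E]

theorem registerProj_apply_of_mem {S : Set X} {x : X} (hx : x ∈ S) (f : JointSpace X E) :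
    registerProj E S f x = f x := by
  rw [registerProj, blockDiag_apply, if_pos hx]; rfl

theorem registerProj_apply_of_notMem {S : Set X} {x : X} (hx : x ∉ S) (f : JointSpace X E) :
    registerProj E S f x = 0 := by
  rw [registerProj, blockDiag_apply, if_neg hx]; rfl

theorem norm_registerProj_le (S : Set X) : ‖registerProj E S‖ ≤ 1 := by
  refine ContinuousLinearMap.opNorm_le_bound _ zero_le_one fun f => ?_
  rw [one_mul]
  refine lp.norm_mono (by norm_num) fun x => ?_
  by_cases hx : x ∈ S
  · rw [registerProj_apply_of_mem hx]
  · rw [registerProj_apply_of_notMem hx, norm_zero]; exact norm_nonneg _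

open scoped ComplexOrder in
theorem blockDiag_nonneg {T : X → E →L[ℂ] E} {C : ℝ} (hT : ∀ x, ‖T x‖ ≤ C)
    (h : ∀ x, 0 ≤ T x) : 0 ≤ blockDiag T C hT := by
  rw [ContinuousLinearMap.nonneg_iff_isPositive, ContinuousLinearMap.isPositive_iff_complex]
  intro f
  have h0 : ∀ x, 0 ≤ ⟪blockDiag T C hT f x, f x⟫_ℂ := fun x =>
    ((ContinuousLinearMap.nonneg_iff_isPositive _).1 (h x)).inner_nonneg_left (f x)
  have := (lp.hasSum_inner (𝕜 := ℂ) (blockDiag T C hT f) f).nonneg h0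
  obtain ⟨h1, h2⟩ := Complex.nonneg_iff.1 this
  exact ⟨Complex.ext rfl (by simpa using h2), h1⟩

theorem ketbraTensor_nonneg (x : X) {A : E →L[ℂ] E} (hA : 0 ≤ A) :
    0 ≤ (ketbraTensor x A : JointSpace X E →L[ℂ] JointSpace X E) := by
  classical
  have hn : ∀ y, ‖if y = x then A else 0‖ ≤ ‖A‖ := fun y => by
    split_ifs
    · exact le_rfl
    · simp
  have : (ketbraTensor x A : JointSpace X E →L[ℂ] JointSpace X E)
      = blockDiag (fun y => if y = x then A else 0) ‖A‖ hn := by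
    ext f y
    rw [blockDiag_apply]
    by_cases hy : y = x
    · subst hy
      simp [ketbraTensor, lp.evalCLM]
    · simp [ketbraTensor, lp.evalCLM, hy]
  rw [this]
  refine blockDiag_nonneg _ fun y => ?_
  split_ifs
  · exact hA
  · exact le_rfl

variable [CompleteSpace E]

theorem isSelfAdjoint_registerProj (S : Set X) : IsSelfAdjoint (registerProj E S) := by
  refine IsSelfAdjoint.of_nonneg (blockDiag_nonneg _ fun x => ?_)
  split_ifs
  · exact (ContinuousLinearMap.nonneg_iff_isPositive _).2 ContinuousLinearMap.isPositive_id
  · exact le_rfl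

/-- Compressing `1 ⊗ σ` to the outcomes in `S` removes the blocks outside `S`, which are
positive. -/
theorem registerProj_conj_idTensor_le (S : Set X) {σ : E →L[ℂ] E} (hσ : 0 ≤ σ) :
    registerProj E S * idTensor X σ * registerProj E S ≤ idTensor X σ := by
  classical
  have hn : ∀ x, ‖if x ∈ S then (0 : E →L[ℂ] E) else σ‖ ≤ ‖σ‖ := fun x => by
    split_ifs
    · simp
    · exact le_rfl
  have : idTensor X σ - registerProj E S * idTensor X σ * registerProj E S
      = blockDiag (fun x => if x ∈ S then 0 else σ) ‖σ‖ hn := by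
    ext f x
    change σ (f x) - registerProj E S (idTensor X σ (registerProj E S f)) x
      = (if x ∈ S then 0 else σ) (f x)
    by_cases hx : x ∈ S
    · rw [registerProj_apply_of_mem hx, idTensor, blockDiag_apply, registerProj_apply_of_mem hx,
        if_pos hx, sub_self]; rfl
    · rw [registerProj_apply_of_notMem hx, if_neg hx, sub_zero]
  rw [← sub_nonneg, this]
  refine blockDiag_nonneg _ fun x => ?_
  split_ifs
  · exact le_rfl
  · exact hσ

theorem IsCQState.nonneg {ρ : JointSpace X E →L[ℂ] JointSpace X E} (hρ : IsCQState ρ) : 0 ≤ ρ := by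
  obtain ⟨P, ω, hP, -, hω, hsum⟩ := hρ
  exact hsum.nonneg fun x => ofReal_smul_nonneg (ketbraTensor_nonneg x (hω x).1) (hP x)

/-! ### Conditioning on the outcome `S` -/

/-- Conditioning a smoothing of `ρ` on the outcome `S` gives a smoothing of `τ`. -/
theorem projState_mem_stateBall {ρ ρ' : JointSpace X E →L[ℂ] JointSpace X E} (hρ : 0 ≤ ρ)
    (S : Set X) (hp0 : 0 < projProb S ρ) {ε : ℝ} (hε : ε ^ 2 < 2)
    (hρ' : ρ' ∈ stateBall (ε * Real.sqrt (projProb S ρ / 2)) ρ) :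
    projProb S ρ * (1 - ε ^ 2 / 2) ≤ projProb S ρ' ∧
      projState S ρ' ∈ stateBall ε (projState S ρ) := by
  obtain ⟨⟨hρ'0, hρ'1⟩, hdist⟩ := hρ'
  set p := projProb S ρ
  set q := projProb S ρ'
  set Q := registerProj E S
  have hQ : IsSelfAdjoint Q := isSelfAdjoint_registerProj S
  have hQ1 : ‖Q‖ ≤ 1 := norm_registerProj_le S
  -- A positive `toReal` is not the junk value at `∞`.
  have hpA : posTrace (Q * ρ * Q) = ENNReal.ofReal p :=
    (ENNReal.ofReal_toReal (ENNReal.toReal_pos_iff.1 hp0).2.ne).symm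
  have hqB : posTrace (Q * ρ' * Q) = ENNReal.ofReal q :=
    (ENNReal.ofReal_toReal (ne_top_of_le_ne_top (hρ'1 ▸ ENNReal.one_ne_top)
      (posTrace_conj_le hρ'0 hQ hQ1))).symm
  have hq0 : 0 ≤ q := ENNReal.toReal_nonneg
  have hd : traceDist ρ ρ' ≤ ENNReal.ofReal (p * (ε ^ 2 / 2) / 2) := by
    rw [mul_pow, Real.sq_sqrt (by positivity)] at hdist
    convert hdist using 2
    ring
  obtain ⟨h1, h2⟩ := traceDist_normalized_compression_le hρ hρ'0 hQ hQ1 hp0 hq0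
    (show p * (ε ^ 2 / 2) < p by nlinarith) hpA hqB (by positivity) hd
  have hqpos : 0 < q := lt_of_lt_of_le (by nlinarith) h1
  refine ⟨by linarith, ⟨?_, ?_⟩, ?_⟩
  · exact ofReal_smul_nonneg (hQ.conjugate_nonneg hρ'0) (inv_nonneg.2 hq0)
  · refine (posTrace_smul _ (inv_nonneg.2 hq0)).trans ?_
    change _ * posTrace (Q * ρ' * Q) = 1
    rw [hqB, ← ENNReal.ofReal_mul (inv_nonneg.2 hq0), inv_mul_cancel₀ hqpos.ne',
      ENNReal.ofReal_one]
  · rwa [mul_div_cancel_left₀ _ hp0.ne'] at h2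

/-- Conditioning on the outcome `S` costs at most `-log₂ q` of min-entropy, `q` being its
probability. -/
theorem condMinEntropy_add_logb_le (ρ : JointSpace X E →L[ℂ] JointSpace X E)
    (S : Set X) (hq : 0 < projProb S ρ) :
    condMinEntropy ρ + ((Real.logb 2 (projProb S ρ) : ℝ) : EReal)
      ≤ condMinEntropy (projState S ρ) := by
  rw [← EReal.le_sub_iff_add_le (by simp) (by simp)]
  refine iSup₂_le fun σ hσ => iSup₂_le fun l hl => ?_
  rw [EReal.le_sub_iff_add_le (by simp) (by simp), ← EReal.coe_add]
  refine le_iSup₂_of_le σ hσ (le_iSup₂_of_le (l + Real.logb 2 (projProb S ρ)) ?_ le_rfl)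
  have hQ := isSelfAdjoint_registerProj (E := E) S
  rw [neg_add, Real.rpow_add two_pos, Real.rpow_neg two_pos.le (Real.logb _ _),
    Real.rpow_logb two_pos (by norm_num) hq, mul_comm, Complex.ofReal_mul, mul_smul, projState,
    ← sub_nonneg, ← smul_sub]
  refine ofReal_smul_nonneg (sub_nonneg.2 ?_) (inv_nonneg.2 hq.le)
  have h1 := hQ.conjugate_nonneg (sub_nonneg.2 hl)
  rw [mul_sub, sub_mul, sub_nonneg, mul_smul_comm, smul_mul_assoc] at h1
  refine le_trans h1 ?_
  rw [← sub_nonneg, ← smul_sub]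
  exact ofReal_smul_nonneg (sub_nonneg.2 (registerProj_conj_idTensor_le S hσ.1)) (by positivity)

end Register

theorem mainTheorem1 {X E : Type*} [NormedAddCommGroup E] [InnerProductSpace ℂ E]
    [CompleteSpace E] (ρ : JointSpace X E →L[ℂ] JointSpace X E) (hρ : IsCQState ρ)
    (S : Set X) (p : ℝ) (hp : p = projProb S ρ) (hp0 : 0 < p)
    (ε : ℝ) (hε0 : 0 ≤ ε) (hε : ε < Real.sqrt 2) :
    condSmoothMinEntropy (ε * Real.sqrt (p / 2)) ρ
        + ((Real.logb 2 (p * (1 - ε ^ 2 / 2)) : ℝ) : EReal)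
      ≤ condSmoothMinEntropy ε (projState S ρ) := by
  subst hp
  have hε2 : ε ^ 2 < 2 := (Real.lt_sqrt hε0).1 hε
  rw [← EReal.le_sub_iff_add_le (by simp) (by simp)]
  refine iSup₂_le fun ρ' hρ' => ?_
  rw [EReal.le_sub_iff_add_le (by simp) (by simp)]
  obtain ⟨hq, hmem⟩ := projState_mem_stateBall hρ.nonneg S hp0 hε2 hρ'
  have hpos : 0 < projProb S ρ * (1 - ε ^ 2 / 2) := mul_pos hp0 (by linarith)
  refine le_iSup₂_of_le _ hmem (le_trans ?_
    (condMinEntropy_add_logb_le ρ' S (hpos.trans_le hq)))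
  refine add_le_add_right (EReal.coe_le_coe ?_) _
  exact Real.logb_le_logb_of_le one_lt_two hpos hq
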